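/- Let $\mathbb{H}$ be the quaternions with units $\mathbf{i},\mathbf{j},\mathbf{k}$, let $\varepsilon$ be the dual unit ($\varepsilon^2=0$, $\varepsilon$ central), and let $t$ be an indeterminate commuting with everything; bars denote quaternion conjugation. A *plane polynomial* is $u=\vec u+\varepsilon u_0$ with $\vec u=u_1\mathbf{i}+u_2\mathbf{j}+u_3\mathbf{k}$ and $u_0,\dots,u_3\in\mathbb{R}[t]$. Write $\operatorname{rgcd}$ for the monic greatest common divisor of the real coefficient polynomials. The plane polynomial $u$ is *reduced* if $\operatorname{rgcd}(u)=1$, *kinematic* if its norm $u\bar u=u_1^2+u_2^2+u_3^2$ is a square in $\mathbb{R}[t]$, and *saturated* if $\vec u\neq 0$ and every real zero of $\operatorname{rgcd}(\vec u)$ has even multiplicity. It is *minimally saturated* if it is saturated and there is no $f\in\mathbb{R}[t]$ of positive degree such that $u/f$ is a saturated polynomial. The *saturating factor* of $u$ with $\vec u\ne0$ is the monic $\ell\in\mathbb{R}[t]$ of minimal degree such that $\ell u$ is saturated ($\ell=1$ if $u$ is saturated). **Proposition.** Let $u$ be a reduced kinematic plane polynomial with $\vec u\neq 0$ and let $\ell$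 be its saturating factor. Then $\ell u$ is minimally saturated, $\ell^2$ divides $\operatorname{rgcd}(\ell\vec u)$, and the following hold. 1. For $h\in\mathbb{R}[t]$, the system $$P\mathbf{k}\bar P=h\,\ell\vec u,\qquad P\mathbf{k}\bar D-D\mathbf{k}\bar P=h\,\ell u_0,\qquad P\bar D+D\bar P=0$$ has a solution $P,D\in\mathbb{H}[t]$ with $P\ne0$ if and only if $h$ is a multiple of $\operatorname{rgcd}(\ell\vec u)/\ell^2$ and $h\ell u$ is saturated. 2. Solutions of minimal degree occur for $h=\operatorname{rgcd}(\ell\vec u)/\ell^2$: for this $h$ there is a solution $C=P+\varepsilon D$ with $P\neq 0$ whose degree (the maximum of the degrees of its coefficient polynomials) is at most the degree of every solution $C'=P'+\varepsilon D'$ with $P'\ne0$ for every $h\in\mathbb{R}[t]$. -/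

import Mathlib

open Polynomial

noncomputable section

/-- Quaternion polynomials `ℍ[t]`, written as quaternions with coefficients in `ℝ[t]`: the
indeterminate commutes with everything and is fixed by the conjugation `star`. -/
abbrev QuatPoly : Type := Quaternion ℝ[X]

/-- Dual quaternion polynomials `P + ε D`; `TrivSqZeroExt.fst` is the primal part `P` and
`TrivSqZeroExt.snd` is the dual part `D`. -/
abbrev DualQuatPoly : Type := DualNumber QuatPoly

namespace QuatPoly

/-- The quaternion unit `𝐤`. -/
def k : QuatPoly := ⟨0, 0, 0, 1⟩

/-- The (monic) greatest common divisor of the four real coefficient polynomials. -/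
def rgcd (q : QuatPoly) : ℝ[X] :=
  normalize (EuclideanDomain.gcd q.re
    (EuclideanDomain.gcd q.imI (EuclideanDomain.gcd q.imJ q.imK)))

/-- The degree of a quaternion polynomial. -/
def deg (q : QuatPoly) : ℕ :=
  max (max q.re.natDegree q.imI.natDegree) (max q.imJ.natDegree q.imK.natDegree)

end QuatPoly

namespace DualQuatPoly

/-- Dual quaternion conjugation `P + ε D ↦ P̄ + ε D̄`. -/
def conj (u : DualQuatPoly) : DualQuatPoly :=
  TrivSqZeroExt.inl (star u.fst) + TrivSqZeroExt.inr (star u.snd)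

/-- The (monic) greatest common divisor of the eight real coefficient polynomials. -/
def rgcd (u : DualQuatPoly) : ℝ[X] :=
  normalize (EuclideanDomain.gcd (QuatPoly.rgcd u.fst) (QuatPoly.rgcd u.snd))

/-- The degree of a dual quaternion polynomial. -/
def deg (u : DualQuatPoly) : ℕ := max (QuatPoly.deg u.fst) (QuatPoly.deg u.snd)

/-- `u = u₁ 𝐢 + u₂ 𝐣 + u₃ 𝐤 + ε u₀`: the primal part is a vector, the dual part a scalar. -/
def IsPlane (u : DualQuatPoly) : Prop :=
  u.fst.re = 0 ∧ u.snd.imI = 0 ∧ u.snd.imJ = 0 ∧ u.snd.imK = 0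

/-- No real polynomial factor of positive degree. -/
def IsReduced (u : DualQuatPoly) : Prop := rgcd u = 1

/-- The norm `u ū` is the square of a real polynomial. -/
def IsKinematic (u : DualQuatPoly) : Prop :=
  ∃ s : ℝ[X], u * conj u = TrivSqZeroExt.inl ((s ^ 2 : ℝ[X]) : QuatPoly)

/-- All real zeros of the real gcd of the vector part have even multiplicity. (If the vector part
vanishes, zeros have infinite multiplicity, and `u` does not count as saturated.) -/
def IsSaturated (u : DualQuatPoly) : Prop :=
  QuatPoly.rgcd u.fst ≠ 0 ∧ ∀ a : ℝ, Even ((QuatPoly.rgcd u.fst).rootMultiplicity a)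

/-- `u` is saturated, and no quotient `u / f` by a real polynomial `f` of positive degree is a
saturated polynomial. -/
def IsMinimallySaturated (u : DualQuatPoly) : Prop :=
  IsSaturated u ∧
    ∀ (f : ℝ[X]) (w : DualQuatPoly), 0 < f.natDegree → u = f • w → ¬ IsSaturated w

/-- `l` is the monic polynomial of minimal degree for which `l u` is saturated. -/
def IsSaturatingFactor (u : DualQuatPoly) (l : ℝ[X]) : Prop :=
  l.Monic ∧ IsSaturated (l • u) ∧
    ∀ m : ℝ[X], m.Monic → IsSaturated (m • u) → l.natDegree ≤ m.natDegree

/-- Motion polynomials `P + ε D`: non-zero primal part and Study condition `P D̄ + D P̄ = 0`. -/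
def IsMotion (C : DualQuatPoly) : Prop :=
  C.fst ≠ 0 ∧ C.fst * star C.snd + C.snd * star C.fst = 0

/-- The motion polynomial `C = P + ε D` is a solution of the system `P 𝐤 P̄ = h u⃗`,
`P 𝐤 D̄ - D 𝐤 P̄ = h u₀`, `P D̄ + D P̄ = 0`. -/
def IsSolution (u : DualQuatPoly) (h : ℝ[X]) (C : DualQuatPoly) : Prop :=
  IsMotion C ∧
    C.fst * QuatPoly.k * star C.fst = h • u.fst ∧
    C.fst * QuatPoly.k * star C.snd - C.snd * QuatPoly.k * star C.fst = h • u.snd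

end DualQuatPoly

end

/-!
Right multiplication by `𝐤` makes `ℍ[t]` a free module of rank two over `ℂ[t]`, with basis `1, 𝐢`.
If `P` has coordinates `z, w` in this basis, then the coordinates of the vector `P 𝐤 P̄` are
`z z̄ - w w̄` and the two real parts of `2 z w̄`, as in the Hopf map, while the Study condition and
the dual part of the system together become the single equation `z̄ d + w̄ e = (v / 2) I` over
`ℂ[t]`, where `d, e` are the coordinates of `D` and `v` is the prescribed dual part. As `ℂ[t]` is
Euclidean, everything is governed by `G = gcd (z, w)`: the gcd of the coefficients of `P 𝐤 P̄` is
`G Ḡ` (`QuatPoly.exists_gcd_parts`), and a dual part exists if and only if `G` divides `v`.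
Conversely, every primitive vector polynomial whose norm is a square is `Q 𝐤 Q̄` for some `Q`
(`QuatPoly.exists_sandwich_eq`), where a coordinate of `Q` is, up to conjugation and a constant
factor, a gcd in `ℂ[t]`.

Let `g` be the gcd of the vector part of `u`, and consider a solution for the factor `c = h ℓ` of
`u`. Then `c g` is a constant multiple of `G Ḡ`, so its real zeros have even multiplicity. Since `G`
divides `c g` and `c u₀`, and `g` and `u₀` are coprime, `G` divides `c`. Hence `g` divides `Ḡ`,
therefore also `G`, and finally `c` (`DualQuatPoly.IsSolution.rgcd_dvd_and_isSaturated`).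
Conversely, if `c = g m` and `c g` has real zeros of even multiplicity only, then so does `m`, which
makes `m` up to sign a norm `M M̄` (`ComplexPoly.exists_norm_of_even`), and `P = g M Q` with
`Q 𝐤 Q̄ = ± u⃗ / g` extends to a solution because `g M` divides `c u₀`
(`DualQuatPoly.exists_isSolution`). The saturating factor `ℓ` is the product of the `t - a` over the
real zeros `a` of `g` of odd multiplicity; it divides `g`, and `g ∣ h ℓ` means `g / ℓ ∣ h`.

For the minimal degree take `m = M = 1`, so that `P = g Q`. With `n = deg Q`, the Bezout equation
for the dual part has a solution of degree at most `max n (deg u₀ - n)`. Any other solution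
`P' + ε D'`, for the factor `c`, satisfies `2 deg P' = deg c + deg g + 2 n` and
`deg c + deg u₀ ≤ deg P' + deg D'`; since `g ∣ c`, its degree is at least as large.
-/

noncomputable section

/-! ### Complex polynomials with conjugation -/

namespace ComplexPoly

/-- The complex polynomial `a + b I` with real part `a` and imaginary part `b`. -/
def ofParts (a b : ℝ[X]) : ℂ[X] :=
  a.map Complex.ofRealHom + C Complex.I * b.map Complex.ofRealHom

/-- Conjugation of the coefficients of a complex polynomial; it fixes the indeterminate. -/
def conj : ℂ[X] →+* ℂ[X] := mapRingHom (starRingEnd ℂ)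

theorem conj_conj (z : ℂ[X]) : conj (conj z) = z := by
  ext n
  simp [conj]

theorem conj_map_ofReal (a : ℝ[X]) :
    conj (a.map Complex.ofRealHom) = a.map Complex.ofRealHom := by
  ext n
  simp [conj]

theorem conj_C (c : ℂ) : conj (C c) = C (starRingEnd ℂ c) := by
  simp [conj]

theorem natDegree_conj (z : ℂ[X]) : (conj z).natDegree = z.natDegree :=
  natDegree_map _

theorem conj_dvd_conj {z w : ℂ[X]} (h : z ∣ w) : conj z ∣ conj w := map_dvd conj h

theorem conj_ne_zero {z : ℂ[X]} (h : z ≠ 0) : conj z ≠ 0 := by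
  intro h0
  apply h
  rw [← conj_conj z, h0, map_zero]

theorem C_I_sq : (C Complex.I * C Complex.I : ℂ[X]) = -1 := by
  rw [← C_mul, Complex.I_mul_I]
  simp

theorem conj_ofParts (a b : ℝ[X]) : conj (ofParts a b) = ofParts a (-b) := by
  simp [ofParts, conj_map_ofReal, conj_C]

theorem ofParts_mul (a b c d : ℝ[X]) :
    ofParts a b * ofParts c d = ofParts (a * c - b * d) (a * d + b * c) := by
  simp only [ofParts, Polynomial.map_sub, Polynomial.map_add, Polynomial.map_mul]
  linear_combination (b.map Complex.ofRealHom * d.map Complex.ofRealHom) * C_I_sq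

theorem ofParts_add (a b c d : ℝ[X]) :
    ofParts a b + ofParts c d = ofParts (a + c) (b + d) := by
  simp only [ofParts, Polynomial.map_add]
  ring

theorem ofParts_sub (a b c d : ℝ[X]) :
    ofParts a b - ofParts c d = ofParts (a - c) (b - d) := by
  simp only [ofParts, Polynomial.map_sub]
  ring

theorem ofParts_zero_right (a : ℝ[X]) : ofParts a 0 = a.map Complex.ofRealHom := by
  simp [ofParts]

theorem two_eq_ofParts : (2 : ℂ[X]) = ofParts 2 0 := by
  simp [ofParts]

theorem coeff_ofParts (a b : ℝ[X]) (n : ℕ) :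
    (ofParts a b).coeff n = ⟨a.coeff n, b.coeff n⟩ := by
  apply Complex.ext <;> simp [ofParts]

theorem ofParts_inj {a b c d : ℝ[X]} : ofParts a b = ofParts c d ↔ a = c ∧ b = d := by
  constructor
  · intro h
    have h' : ∀ n, a.coeff n = c.coeff n ∧ b.coeff n = d.coeff n := by
      intro n
      have := congrArg (fun z => coeff z n) h
      simpa only [coeff_ofParts, Complex.mk.injEq] using this
    exact ⟨ext fun n => (h' n).1, ext fun n => (h' n).2⟩
  · rintro ⟨rfl, rfl⟩
    rfl

theorem exists_ofParts (z : ℂ[X]) : ∃ a b : ℝ[X], z = ofParts a b := by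
  induction z using Polynomial.induction_on' with
  | add p q hp hq =>
    obtain ⟨a, b, rfl⟩ := hp
    obtain ⟨c, d, rfl⟩ := hq
    exact ⟨_, _, ofParts_add a b c d⟩
  | monomial n c =>
    refine ⟨monomial n c.re, monomial n c.im, ?_⟩
    ext m
    rw [coeff_ofParts]
    simp only [coeff_monomial]
    split_ifs <;> rfl

theorem map_mul_ofParts (f a b : ℝ[X]) :
    f.map Complex.ofRealHom * ofParts a b = ofParts (f * a) (f * b) := by
  rw [← ofParts_zero_right, ofParts_mul]
  simp

theorem map_dvd_ofParts {f a b : ℝ[X]} :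
    f.map Complex.ofRealHom ∣ ofParts a b ↔ f ∣ a ∧ f ∣ b := by
  constructor
  · rintro ⟨z, hz⟩
    obtain ⟨c, d, rfl⟩ := exists_ofParts z
    rw [map_mul_ofParts, ofParts_inj] at hz
    exact ⟨⟨c, hz.1⟩, ⟨d, hz.2⟩⟩
  · rintro ⟨⟨c, rfl⟩, ⟨d, rfl⟩⟩
    exact ⟨ofParts c d, (map_mul_ofParts f c d).symm⟩

theorem map_dvd_map_iff {f a : ℝ[X]} :
    f.map Complex.ofRealHom ∣ a.map Complex.ofRealHom ↔ f ∣ a := by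
  rw [← ofParts_zero_right a, map_dvd_ofParts]
  simp

theorem exists_mul_conj_eq (z : ℂ[X]) :
    ∃ n : ℝ[X], z * conj z = n.map Complex.ofRealHom := by
  obtain ⟨a, b, rfl⟩ := exists_ofParts z
  refine ⟨a * a + b * b, ?_⟩
  rw [conj_ofParts, ofParts_mul, ← ofParts_zero_right]
  congr 1 <;> ring

theorem natDegree_le_of_ofParts (a b : ℝ[X]) :
    a.natDegree ≤ (ofParts a b).natDegree ∧ b.natDegree ≤ (ofParts a b).natDegree := by
  constructor
  · refine natDegree_le_iff_coeff_eq_zero.2 fun n hn => ?_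
    have := coeff_eq_zero_of_natDegree_lt hn
    rw [coeff_ofParts] at this
    exact congrArg Complex.re this
  · refine natDegree_le_iff_coeff_eq_zero.2 fun n hn => ?_
    have := coeff_eq_zero_of_natDegree_lt hn
    rw [coeff_ofParts] at this
    exact congrArg Complex.im this

theorem natDegree_ofParts_le (a b : ℝ[X]) :
    (ofParts a b).natDegree ≤ max a.natDegree b.natDegree := by
  refine natDegree_le_iff_coeff_eq_zero.2 fun n hn => ?_
  rw [coeff_ofParts, coeff_eq_zero_of_natDegree_lt (lt_of_le_of_lt (le_max_left _ _) hn),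
    coeff_eq_zero_of_natDegree_lt (lt_of_le_of_lt (le_max_right _ _) hn)]
  rfl

/-- Every real zero of a norm has twice its multiplicity in the complex factor. -/
theorem rootMultiplicity_of_mul_conj {z : ℂ[X]} {n : ℝ[X]} (hz : z ≠ 0)
    (h : z * conj z = n.map Complex.ofRealHom) (a : ℝ) : Even (n.rootMultiplicity a) := by
  have h1 : n.rootMultiplicity a = (z * conj z).rootMultiplicity (a : ℂ) := by
    rw [h]
    exact eq_rootMultiplicity_map Complex.ofRealHom.injective a
  have h2 : (conj z).rootMultiplicity (a : ℂ) = z.rootMultiplicity (a : ℂ) := by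
    have := eq_rootMultiplicity_map (p := z) (starRingEnd ℂ).injective (a : ℂ)
    rw [Complex.conj_ofReal] at this
    exact this.symm
  rw [h1, rootMultiplicity_mul (mul_ne_zero hz (conj_ne_zero hz)), h2]
  exact ⟨_, rfl⟩

/-- A real polynomial all of whose real zeros have even multiplicity is, up to sign, the norm of a
complex polynomial: real zeros are split off in pairs, and non-real ones together with their
conjugates. -/
theorem exists_norm_of_even {m : ℝ[X]} (hm : m ≠ 0)
    (he : ∀ a : ℝ, Even (m.rootMultiplicity a)) :
    ∃ M : ℂ[X], M * conj M = m.map Complex.ofRealHom ∨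
      M * conj M = (-m).map Complex.ofRealHom := by
  induction hd : m.natDegree using Nat.strong_induction_on generalizing m with
  | _ d ih =>
  -- splitting off the norm `r` of a non-constant complex factor `R`
  have split : ∀ (R : ℂ[X]) (r m' : ℝ[X]), R ≠ 0 → R * conj R = r.map Complex.ofRealHom →
      0 < r.natDegree → m = r * m' → ∃ M : ℂ[X], M * conj M = m.map Complex.ofRealHom ∨
      M * conj M = (-m).map Complex.ofRealHom := by
    intro R r m' hR hRr hr hmr
    have hr0 : r ≠ 0 := by
      rintro rfl
      simp at hr
    have hm' : m' ≠ 0 := by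
      rintro rfl
      simp [hmr] at hm
    have hdeg : m'.natDegree < d := by
      rw [← hd, hmr, natDegree_mul hr0 hm']
      omega
    obtain ⟨M, hM⟩ := ih _ hdeg hm' (fun a => by
      have h1 := he a
      rw [hmr, rootMultiplicity_mul (mul_ne_zero hr0 hm')] at h1
      exact (Nat.even_add.1 h1).1 (rootMultiplicity_of_mul_conj hR hRr a)) rfl
    refine ⟨R * M, hM.imp (fun h => ?_) (fun h => ?_)⟩
    · rw [hmr, map_mul, Polynomial.map_mul, ← hRr, ← h]
      ring
    · rw [hmr, map_mul, ← mul_neg, Polynomial.map_mul, ← hRr, ← h]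
      ring
  by_cases hconst : m.natDegree = 0
  · rw [eq_C_of_natDegree_eq_zero hconst]
    refine ⟨C (Real.sqrt |m.coeff 0| : ℂ), ?_⟩
    have h1 : (C (Real.sqrt |m.coeff 0| : ℂ)) * conj (C (Real.sqrt |m.coeff 0| : ℂ)) =
        (C |m.coeff 0|).map Complex.ofRealHom := by
      rw [conj_C, Complex.conj_ofReal, ← C_mul, ← Complex.ofReal_mul,
        Real.mul_self_sqrt (abs_nonneg _), map_C]
      rfl
    rw [h1, ← C_neg]
    rcases abs_choice (m.coeff 0) with h | h
    · left; rw [h]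
    · right; rw [h]
  · obtain ⟨z, hz⟩ := Complex.exists_root (f := m.map Complex.ofRealHom) (by
      rw [degree_map]
      exact natDegree_pos_iff_degree_pos.1 (Nat.pos_of_ne_zero hconst))
    by_cases him : z.im = 0
    · obtain ⟨a, rfl⟩ : ∃ a : ℝ, z = a := ⟨z.re, Complex.ext rfl (by simp [him])⟩
      have hroot : m.IsRoot a := by
        have : (m.map Complex.ofRealHom).eval (Complex.ofRealHom a) = 0 := hz
        rw [eval_map_apply] at this
        exact Complex.ofReal_eq_zero.1 this
      have h2 : 2 ≤ m.rootMultiplicity a := by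
        have h1 := (rootMultiplicity_pos hm).2 hroot
        obtain ⟨k, hk⟩ := he a
        omega
      obtain ⟨m', hm'⟩ := (le_rootMultiplicity_iff hm).1 h2
      refine split (X - C (a : ℂ)) ((X - C a) ^ 2) m' (X_sub_C_ne_zero _) ?_ ?_ hm'
      · rw [map_sub, conj_C, Complex.conj_ofReal]
        simp [conj, sq]
      · simp
    · obtain ⟨m', hm'⟩ := quadratic_dvd_of_aeval_eq_zero_im_ne_zero m
        (z := z) (by rw [aeval_def, ← eval_map]; exact hz) him
      refine split (X - C z) _ m' (X_sub_C_ne_zero _) ?_ ?_ hm'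
      · have h1 : (z + starRingEnd ℂ z) = ((2 * z.re : ℝ) : ℂ) := Complex.add_conj z
        have h2 : z * starRingEnd ℂ z = ((‖z‖ ^ 2 : ℝ) : ℂ) := by
          rw [Complex.mul_conj, Complex.normSq_eq_norm_sq]
        have h3 : conj X = X := by simp [conj]
        rw [map_sub, conj_C, h3]
        simp only [Polynomial.map_add, Polynomial.map_sub, Polynomial.map_mul, Polynomial.map_pow,
          map_X, map_C, Complex.ofRealHom_eq_coe]
        rw [← h1, ← h2, C_add, C_mul]
        ring
      · have h : (X ^ 2 - C (2 * z.re) * X + C (‖z‖ ^ 2) : ℝ[X]).natDegree = 2 := by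
          compute_degree!
        rw [h]
        norm_num

/-! ### Hopf coordinates and Bezout equations over complex polynomials -/

/-- A common factor of the Hopf coordinates `n (x x̄ - y ȳ)`, `n x ȳ`, `n x̄ y` of a pair with
Bezout relation `α x + β y = 1` divides `n`. -/
theorem dvd_of_dvd_hopf {F n x y x' y' α β α' β' : ℂ[X]} (h : α * x + β * y = 1)
    (h' : α' * x' + β' * y' = 1) (h1 : F ∣ n * (x * y')) (h2 : F ∣ n * (x' * y))
    (h3 : F ∣ n * (x * x' - y * y')) : F ∣ n := by
  obtain ⟨e1, h1⟩ := h1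
  obtain ⟨e2, h2⟩ := h2
  obtain ⟨e3, h3⟩ := h3
  -- `(x x')²` and `(y y')²` are combinations of the three coordinates
  have hx : F ∣ n * (x * x') ^ 2 := ⟨x * x' * e3 + x' * y * e1, by
    linear_combination (x * x') * h3 + (x' * y) * h1⟩
  have hy : F ∣ n * (y * y') ^ 2 := ⟨-(y * y') * e3 + x' * y * e1, by
    linear_combination (-(y * y')) * h3 + (x' * y) * h1⟩
  obtain ⟨e4, h4⟩ := hx
  obtain ⟨e5, h5⟩ := hy
  have key : n = n * ((α * x + β * y) ^ 2 * (α' * x' + β' * y') ^ 2) := by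
    rw [h, h']; ring
  rw [key]
  refine ⟨α ^ 2 * α' ^ 2 * e4 + β ^ 2 * β' ^ 2 * e5
    + α ^ 2 * (2 * α' * β' * x * x' + β' ^ 2 * x * y') * e1
    + 2 * α * β * (α' ^ 2 * x * x' * e2 + 2 * α' * β' * x * y' * e2 + β' ^ 2 * y * y' * e1)
    + β ^ 2 * (α' ^ 2 * x' * y + 2 * α' * β' * y * y') * e2, ?_⟩
  linear_combination α ^ 2 * α' ^ 2 * h4 + β ^ 2 * β' ^ 2 * h5
    + α ^ 2 * (2 * α' * β' * x * x' + β' ^ 2 * x * y') * h1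
    + 2 * α * β * (α' ^ 2 * x * x' * h2 + 2 * α' * β' * x * y' * h2 + β' ^ 2 * y * y' * h1)
    + β ^ 2 * (α' ^ 2 * x' * y + 2 * α' * β' * y * y') * h2

/-- A Bezout equation over `K[t]` has a solution of low degree, obtained by reducing the first
coordinate modulo the coefficient of larger degree. -/
theorem exists_bezout_natDegree_le {K : Type*} [Field K] {p q : K[X]} (hpq : IsCoprime p q)
    (v : K[X]) : ∃ x y : K[X], p * x + q * y = v ∧
      x.natDegree ≤ max (max p.natDegree q.natDegree)
        (v.natDegree - max p.natDegree q.natDegree) ∧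
      y.natDegree ≤ max (max p.natDegree q.natDegree)
        (v.natDegree - max p.natDegree q.natDegree) := by
  wlog hle : p.natDegree ≤ q.natDegree generalizing p q
  · obtain ⟨x, y, h, hx, hy⟩ := this hpq.symm (le_of_not_ge hle)
    rw [max_comm q.natDegree] at hx hy
    exact ⟨y, x, by rw [← h, add_comm], hy, hx⟩
  rw [max_eq_right hle]
  by_cases hq : q = 0
  · subst hq
    have hp0 : p.natDegree = 0 := by simpa using hle
    have hu : IsUnit p := isCoprime_zero_right.1 hpq
    obtain ⟨r, hr⟩ := hu.exists_right_inv
    refine ⟨r * v, 0, ?_, ?_, by simp⟩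
    · rw [← mul_assoc, hr]; ring
    · have hr0 : r.natDegree = 0 := natDegree_eq_zero_of_isUnit (IsUnit.of_mul_eq_one_right p hr)
      refine natDegree_mul_le.trans ?_
      simp [hr0]
  obtain ⟨a, b, hab⟩ := hpq
  have hx : (a * v % q).natDegree ≤ q.natDegree := natDegree_le_natDegree (degree_mod_lt _ hq).le
  refine ⟨a * v % q, b * v + p * (a * v / q), ?_, hx.trans (le_max_left _ _), ?_⟩
  · have := EuclideanDomain.div_add_mod (a * v) q
    linear_combination v * hab + p * this
  · set y := b * v + p * (a * v / q) with hy
    have hqy : q * y = v - p * (a * v % q) := by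
      have := EuclideanDomain.div_add_mod (a * v) q
      rw [hy]
      linear_combination v * hab + p * this
    by_cases hy0 : y = 0
    · simp [hy0]
    have h1 : q.natDegree + y.natDegree ≤ max v.natDegree (q.natDegree + q.natDegree) := by
      rw [← natDegree_mul hq hy0, hqy]
      refine (natDegree_sub_le _ _).trans (max_le_max le_rfl ?_)
      exact natDegree_mul_le.trans (add_le_add hle hx)
    rcases le_max_iff.1 h1 with h | h
    · refine le_trans ?_ (le_max_right _ _)
      omega
    · refine le_trans ?_ (le_max_left _ _)
      omega

/-- Factorization of a pair of complex polynomials by their greatest common divisor. -/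
theorem exists_gcd_mul {z w : ℂ[X]} (h : z ≠ 0 ∨ w ≠ 0) :
    ∃ G x y α β : ℂ[X], G ≠ 0 ∧ z = G * x ∧ w = G * y ∧ α * x + β * y = 1 := by
  classical
  have hG : EuclideanDomain.gcd z w ≠ 0 := by
    intro h0
    rw [EuclideanDomain.gcd_eq_zero_iff] at h0
    rcases h with h | h
    · exact h h0.1
    · exact h h0.2
  obtain ⟨x, hx⟩ := EuclideanDomain.gcd_dvd_left z w
  obtain ⟨y, hy⟩ := EuclideanDomain.gcd_dvd_right z w
  refine ⟨_, x, y, EuclideanDomain.gcdA z w, EuclideanDomain.gcdB z w, hG, hx, hy, ?_⟩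
  apply mul_left_cancel₀ hG
  have := EuclideanDomain.gcd_eq_gcd_ab z w
  calc _ = z * EuclideanDomain.gcdA z w + w * EuclideanDomain.gcdB z w := by
        nth_rw 4 [hx]
        nth_rw 6 [hy]
        ring
    _ = _ := by rw [← this, mul_one]

/-- If the real polynomials `a ≠ 0` and `b` satisfy `a b = ζ ζ̄` and `a, b, ζ, ζ̄` have no common
factor, then `a` is up to a constant the norm of `gcd (a, ζ)`, because
`gcd (a, ζ) gcd (a, ζ̄) = gcd (a², a ζ, a ζ̄, a b) = a`. -/
theorem exists_norm_eq_of_mul_eq {a b : ℝ[X]} {ζ : ℂ[X]} (ha : a ≠ 0)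
    (hab : (a * b).map Complex.ofRealHom = ζ * conj ζ)
    (hcop : ∀ f : ℂ[X], f ∣ a.map Complex.ofRealHom → f ∣ b.map Complex.ofRealHom → f ∣ ζ →
      f ∣ conj ζ → IsUnit f) :
    ∃ q r : ℂ[X], ζ = q * conj r ∧
      ((q * conj q = a.map Complex.ofRealHom ∧ r * conj r = b.map Complex.ofRealHom) ∨
      (q * conj q = -a.map Complex.ofRealHom ∧ r * conj r = -b.map Complex.ofRealHom)) := by
  set A := a.map Complex.ofRealHom with hA
  set B := b.map Complex.ofRealHom with hB
  have hAc : conj A = A := conj_map_ofReal a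
  have hBc : conj B = B := conj_map_ofReal b
  have hA0 : A ≠ 0 := (Polynomial.map_ne_zero_iff Complex.ofRealHom.injective).2 ha
  rw [Polynomial.map_mul, ← hA, ← hB] at hab
  obtain ⟨G, x, y, α, β, hG, hAx, hζy, hxy⟩ := exists_gcd_mul (w := ζ) (Or.inl hA0)
  have hAx' : A = conj G * conj x := by rw [← hAc, hAx, map_mul]
  have hζy' : conj ζ = conj G * conj y := by rw [hζy, map_mul]
  have hxy' : conj α * conj x + conj β * conj y = 1 := by
    rw [← map_mul, ← map_mul, ← map_add, hxy, map_one]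
  have hG' := conj_ne_zero hG
  obtain ⟨E, hE⟩ : A ∣ G * conj G := by
    refine ⟨α * conj α * A + α * conj β * conj ζ + β * conj α * ζ + β * conj β * B, ?_⟩
    calc G * conj G = (α * (G * x) + β * (G * y)) *
          (conj α * (conj G * conj x) + conj β * (conj G * conj y)) := by
          linear_combination (-(G * conj G)) * hxy -
            (G * conj G) * (α * x + β * y) * hxy'
      _ = (α * A + β * ζ) * (conj α * A + conj β * conj ζ) := by
          rw [← hAx, ← hAx', ← hζy, ← hζy']
      _ = _ := by linear_combination (-(β * conj β)) * hab
  -- the quotient `E` divides all four of `a, b, ζ, ζ̄`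
  have hEu : IsUnit E := by
    apply hcop
    · refine ⟨x * conj x, mul_left_cancel₀ hA0 ?_⟩
      calc A * A = (G * x) * (conj G * conj x) := by rw [← hAx, ← hAx']
        _ = _ := by linear_combination (x * conj x) * hE
    · refine ⟨y * conj y, mul_left_cancel₀ hA0 ?_⟩
      rw [hab, hζy']
      nth_rw 1 [hζy]
      linear_combination (y * conj y) * hE
    · refine ⟨conj x * y, mul_left_cancel₀ hA0 ?_⟩
      calc A * ζ = (conj G * conj x) * (G * y) := by rw [← hAx', ← hζy]
        _ = _ := by linear_combination (conj x * y) * hE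
    · refine ⟨x * conj y, mul_left_cancel₀ hA0 ?_⟩
      calc A * conj ζ = (G * x) * (conj G * conj y) := by rw [← hAx, ← hζy']
        _ = _ := by linear_combination (x * conj y) * hE
  obtain ⟨e, he, rfl⟩ := isUnit_iff.1 hEu
  have hreal : starRingEnd ℂ e = e := by
    have h1 : A * conj (C e) = A * C e := by
      rw [← hE]
      nth_rw 1 [← hAc]
      rw [← map_mul, ← hE, map_mul, conj_conj, mul_comm]
    exact C_injective (by rw [← conj_C]; exact mul_left_cancel₀ hA0 h1)
  obtain ⟨t, rfl⟩ := Complex.conj_eq_iff_real.1 hreal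
  have ht : t ≠ 0 := by
    rintro rfl
    simp at he
  -- rescaling by the square root of the constant
  set s := Real.sqrt |t| with hs
  have hs0 : s ≠ 0 := (Real.sqrt_pos.2 (abs_pos.2 ht)).ne'
  have hss : s * s = |t| := Real.mul_self_sqrt (abs_nonneg t)
  have hinv : (C ((s⁻¹ : ℝ) : ℂ) * C ((s : ℝ) : ℂ) : ℂ[X]) = 1 := by
    rw [← C_mul, ← Complex.ofReal_mul, inv_mul_cancel₀ hs0]
    simp
  have hcs : conj (C ((s : ℝ) : ℂ)) = C ((s : ℝ) : ℂ) := by rw [conj_C, Complex.conj_ofReal]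
  have hci : conj (C ((s⁻¹ : ℝ) : ℂ)) = C ((s⁻¹ : ℝ) : ℂ) := by rw [conj_C, Complex.conj_ofReal]
  set q := C ((s⁻¹ : ℝ) : ℂ) * G with hq
  set r := C ((s : ℝ) : ℂ) * conj y with hr
  have hqr : ζ = q * conj r := by
    rw [hq, hr, map_mul, hcs, conj_conj]
    nth_rw 1 [hζy]
    linear_combination (-(G * y)) * hinv
  have hqq : q * conj q = C ((s⁻¹ * s⁻¹ * t : ℝ) : ℂ) * A := by
    rw [hq, map_mul, hci, Complex.ofReal_mul, Complex.ofReal_mul, C_mul, C_mul]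
    linear_combination (C ((s⁻¹ : ℝ) : ℂ) * C ((s⁻¹ : ℝ) : ℂ)) * hE
  have hmul : q * conj q * (r * conj r) = A * B := by
    rw [hab, hqr, map_mul conj q, conj_conj]
    ring
  refine ⟨q, r, hqr, ?_⟩
  rcases abs_choice t with h | h
  · left
    have h1 : s⁻¹ * s⁻¹ * t = 1 := by
      rw [← mul_inv, hss, h]
      exact inv_mul_cancel₀ ht
    have h2 : q * conj q = A := by simpa [h1] using hqq
    exact ⟨h2, mul_left_cancel₀ hA0 (by rw [← hmul, h2])⟩
  · right
    have h1 : s⁻¹ * s⁻¹ * t = -1 := by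
      rw [← mul_inv, hss, h, inv_neg, neg_mul, inv_mul_cancel₀ ht]
    have h2 : q * conj q = -A := by simpa [h1] using hqq
    exact ⟨h2, mul_left_cancel₀ hA0 (by linear_combination (r * conj r) * h2 - hmul)⟩

/-- A symmetric form of `exists_norm_eq_of_mul_eq`, in which the sign of the constant is absorbed
by exchanging the two factors. -/
theorem exists_hopf {a b : ℝ[X]} {ζ : ℂ[X]} (h0 : a ≠ 0 ∨ b ≠ 0)
    (hab : (a * b).map Complex.ofRealHom = ζ * conj ζ)
    (hcop : ∀ f : ℂ[X], f ∣ a.map Complex.ofRealHom → f ∣ b.map Complex.ofRealHom → f ∣ ζ →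
      f ∣ conj ζ → IsUnit f) :
    ∃ q r : ℂ[X], ζ = q * conj r ∧
      q * conj q - r * conj r = a.map Complex.ofRealHom - b.map Complex.ofRealHom := by
  rcases h0 with ha | hb
  · obtain ⟨q, r, hqr, ⟨h1, h2⟩ | ⟨h1, h2⟩⟩ := exists_norm_eq_of_mul_eq ha hab hcop
    · exact ⟨q, r, hqr, by rw [h1, h2]⟩
    · refine ⟨conj r, conj q, by rw [conj_conj, hqr, mul_comm], ?_⟩
      rw [conj_conj, conj_conj]
      linear_combination h2 - h1
  · obtain ⟨q, r, hqr, ⟨h1, h2⟩ | ⟨h1, h2⟩⟩ := exists_norm_eq_of_mul_eq hb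
      (by rw [mul_comm, hab]) (fun f h1 h2 => hcop f h2 h1)
    · refine ⟨conj r, conj q, by rw [conj_conj, hqr, mul_comm], ?_⟩
      rw [conj_conj, conj_conj]
      linear_combination h2 - h1
    · refine ⟨q, r, hqr, ?_⟩
      linear_combination h1 - h2

end ComplexPoly

open ComplexPoly

namespace QuatPoly

/-! ### Greatest common divisors of the coefficients -/

theorem dvd_rgcd_iff {f : ℝ[X]} {q : QuatPoly} :
    f ∣ rgcd q ↔ f ∣ q.re ∧ f ∣ q.imI ∧ f ∣ q.imJ ∧ f ∣ q.imK := by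
  have h : ∀ a b : ℝ[X], f ∣ EuclideanDomain.gcd a b ↔ f ∣ a ∧ f ∣ b := fun a b =>
    ⟨fun h => ⟨h.trans (EuclideanDomain.gcd_dvd_left a b),
      h.trans (EuclideanDomain.gcd_dvd_right a b)⟩, fun h => EuclideanDomain.dvd_gcd h.1 h.2⟩
  rw [rgcd, dvd_normalize_iff, h, h, h]

theorem normalize_rgcd (q : QuatPoly) : normalize (rgcd q) = rgcd q := by
  rw [rgcd, normalize_idem]

theorem rgcd_eq_normalize {q : QuatPoly} {n : ℝ[X]}
    (h : ∀ f, f ∣ n ↔ f ∣ q.re ∧ f ∣ q.imI ∧ f ∣ q.imJ ∧ f ∣ q.imK) :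
    rgcd q = normalize n := by
  rw [← normalize_rgcd]
  exact normalize_eq_normalize ((h _).2 (dvd_rgcd_iff.1 dvd_rfl))
    (dvd_rgcd_iff.2 ((h _).1 dvd_rfl))

theorem exists_combination_eq_rgcd (q : QuatPoly) :
    ∃ a b c d : ℝ[X], a * q.re + b * q.imI + c * q.imJ + d * q.imK = rgcd q := by
  have h1 := EuclideanDomain.gcd_eq_gcd_ab q.re
    (EuclideanDomain.gcd q.imI (EuclideanDomain.gcd q.imJ q.imK))
  have h2 := EuclideanDomain.gcd_eq_gcd_ab q.imI (EuclideanDomain.gcd q.imJ q.imK)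
  have h3 := EuclideanDomain.gcd_eq_gcd_ab q.imJ q.imK
  obtain ⟨e, he⟩ := (normalize_associated (EuclideanDomain.gcd q.re
    (EuclideanDomain.gcd q.imI (EuclideanDomain.gcd q.imJ q.imK)))).symm.dvd
  generalize EuclideanDomain.gcdB q.re
    (EuclideanDomain.gcd q.imI (EuclideanDomain.gcd q.imJ q.imK)) = B1 at h1
  generalize EuclideanDomain.gcdA q.re
    (EuclideanDomain.gcd q.imI (EuclideanDomain.gcd q.imJ q.imK)) = A1 at h1
  generalize EuclideanDomain.gcdB q.imI (EuclideanDomain.gcd q.imJ q.imK) = B2 at h2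
  generalize EuclideanDomain.gcdA q.imI (EuclideanDomain.gcd q.imJ q.imK) = A2 at h2
  rw [rgcd, he]
  refine ⟨A1 * e, B1 * A2 * e, B1 * B2 * EuclideanDomain.gcdA q.imJ q.imK * e,
    B1 * B2 * EuclideanDomain.gcdB q.imJ q.imK * e, ?_⟩
  linear_combination (-e) * h1 - e * B1 * h2 - e * B1 * B2 * h3

theorem rgcd_smul (f : ℝ[X]) (q : QuatPoly) : rgcd (f • q) = normalize f * rgcd q := by
  rw [← normalize_rgcd q, ← normalize_mul]
  refine rgcd_eq_normalize fun F => ⟨fun h => ?_, fun ⟨h1, h2, h3, h4⟩ => ?_⟩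
  · have hq := dvd_rgcd_iff.1 (dvd_refl (rgcd q))
    exact ⟨h.trans (mul_dvd_mul_left f hq.1), h.trans (mul_dvd_mul_left f hq.2.1),
      h.trans (mul_dvd_mul_left f hq.2.2.1), h.trans (mul_dvd_mul_left f hq.2.2.2)⟩
  · obtain ⟨a, b, c, d, h⟩ := exists_combination_eq_rgcd q
    have h' : f * rgcd q =
        a * (f * q.re) + b * (f * q.imI) + c * (f * q.imJ) + d * (f * q.imK) := by
      rw [← h]
      ring
    rw [h']
    exact dvd_add (dvd_add (dvd_add (h1.mul_left a) (h2.mul_left b)) (h3.mul_left c))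
      (h4.mul_left d)

theorem eq_rgcd_smul (q : QuatPoly) : ∃ w : QuatPoly, q = rgcd q • w := by
  obtain ⟨⟨a, ha⟩, ⟨b, hb⟩, ⟨c, hc⟩, ⟨d, hd⟩⟩ := dvd_rgcd_iff.1 (dvd_refl (rgcd q))
  refine ⟨⟨a, b, c, d⟩, ?_⟩
  ext1
  exacts [ha, hb, hc, hd]

theorem eq_zero_of_coords {P : QuatPoly} (h1 : P.re = 0) (h2 : P.imI = 0) (h3 : P.imJ = 0)
    (h4 : P.imK = 0) : P = 0 :=
  QuaternionAlgebra.ext h1 h2 h3 h4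

/-! ### Complex coordinates of quaternion polynomials -/

/-- The first coordinate of a quaternion polynomial in the basis `1, 𝐢` of the right
`ℂ[t]`-module `ℍ[t]`, where `I` acts as right multiplication by `𝐤`. -/
def fstPart (P : QuatPoly) : ℂ[X] := ofParts P.re P.imK

/-- The second coordinate of a quaternion polynomial in the basis `1, 𝐢` of the right
`ℂ[t]`-module `ℍ[t]`; the sign comes from `𝐢 𝐤 = -𝐣`. -/
def sndPart (P : QuatPoly) : ℂ[X] := ofParts P.imI (-P.imJ)

theorem exists_of_parts (z w : ℂ[X]) : ∃ P : QuatPoly, fstPart P = z ∧ sndPart P = w := by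
  obtain ⟨a, b, rfl⟩ := exists_ofParts z
  obtain ⟨c, d, rfl⟩ := exists_ofParts w
  exact ⟨⟨a, c, -d, b⟩, by simp [fstPart], by simp [sndPart]⟩

theorem parts_ne_zero {P : QuatPoly} (hP : P ≠ 0) : fstPart P ≠ 0 ∨ sndPart P ≠ 0 := by
  by_contra! h
  have h0 : ofParts 0 0 = 0 := by simp [ofParts]
  rw [fstPart, sndPart, ← h0, ofParts_inj, ofParts_inj] at h
  apply hP
  ext1
  · exact h.1.1
  · exact h.2.1
  · exact neg_eq_zero.1 h.2.2
  · exact h.1.2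

@[simp] theorem k_re : k.re = 0 := rfl

@[simp] theorem k_imI : k.imI = 0 := rfl

@[simp] theorem k_imJ : k.imJ = 0 := rfl

@[simp] theorem k_imK : k.imK = 1 := rfl

theorem sandwich_re (P : QuatPoly) : (P * k * star P).re = 0 := by
  simp
  ring

theorem sandwich_imI (P : QuatPoly) :
    (P * k * star P).imI = 2 * (P.re * P.imJ + P.imI * P.imK) := by
  simp
  ring

theorem sandwich_imJ (P : QuatPoly) :
    (P * k * star P).imJ = 2 * (P.imJ * P.imK - P.re * P.imI) := by
  simp
  ring

theorem sandwich_imK (P : QuatPoly) :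
    (P * k * star P).imK = P.re ^ 2 + P.imK ^ 2 - P.imI ^ 2 - P.imJ ^ 2 := by
  simp
  ring

theorem hopf_imK (P : QuatPoly) : fstPart P * conj (fstPart P) - sndPart P * conj (sndPart P) =
    (P * k * star P).imK.map Complex.ofRealHom := by
  rw [← ofParts_zero_right, sandwich_imK, fstPart, sndPart, conj_ofParts, conj_ofParts,
    ofParts_mul, ofParts_mul, ofParts_sub, ofParts_inj]
  constructor <;> ring

theorem hopf_imI_imJ (P : QuatPoly) : 2 * (fstPart P * conj (sndPart P)) =
    ofParts (-(P * k * star P).imJ) (P * k * star P).imI := by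
  rw [two_eq_ofParts, sandwich_imI, sandwich_imJ, fstPart, sndPart, conj_ofParts,
    ofParts_mul, ofParts_mul, ofParts_inj]
  constructor <;> ring

theorem sandwich_eq_of_hopf {P v : QuatPoly} (h0 : v.re = 0)
    (h1 : fstPart P * conj (fstPart P) - sndPart P * conj (sndPart P) =
      v.imK.map Complex.ofRealHom)
    (h2 : 2 * (fstPart P * conj (sndPart P)) = ofParts (-v.imJ) v.imI) :
    P * k * star P = v := by
  rw [hopf_imK] at h1
  rw [hopf_imI_imJ, ofParts_inj] at h2
  ext1
  · rw [sandwich_re, h0]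
  · exact h2.2
  · exact neg_injective h2.1
  · exact map_injective _ Complex.ofRealHom.injective h1

/-- The Study condition and the dual part of the system say that the Hermitian product of the
coordinates of `P` and `D` is `v I / 2`. -/
theorem study_iff {P D v : QuatPoly} (h1 : v.imI = 0) (h2 : v.imJ = 0) (h3 : v.imK = 0) :
    (P * star D + D * star P = 0 ∧ P * k * star D - D * k * star P = v) ↔
      2 * (conj (fstPart P) * fstPart D + conj (sndPart P) * sndPart D) = ofParts 0 v.re := by
  rw [two_eq_ofParts, fstPart, sndPart, fstPart, sndPart, conj_ofParts, conj_ofParts,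
    ofParts_mul, ofParts_mul, ofParts_add, ofParts_mul, ofParts_inj]
  constructor
  · rintro ⟨h4, rfl⟩
    constructor
    · have := congrArg QuaternionAlgebra.re h4
      simp only [Quaternion.re_add, Quaternion.re_mul, Quaternion.re_star, Quaternion.imI_star,
        Quaternion.imJ_star, Quaternion.imK_star] at this
      have h0 : (0 : QuatPoly).re = 0 := rfl
      rw [h0] at this
      linear_combination this
    · simp
      ring
  · rintro ⟨h4, h5⟩
    constructor
    · apply eq_zero_of_coords
      · simp
        linear_combination h4
      all_goals simp; ring
    · ext1
      · rw [← h5]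
        simp
        ring
      · rw [h1]; simp; ring
      · rw [h2]; simp; ring
      · rw [h3]; simp; ring

/-- The greatest common divisor of `P 𝐤 P̄` is the norm of the greatest common divisor `G` of the
complex coordinates of `P`. -/
theorem exists_gcd_parts {P : QuatPoly} (hP : P ≠ 0) :
    ∃ (G x y : ℂ[X]) (n : ℝ[X]), G ≠ 0 ∧ fstPart P = G * x ∧ sndPart P = G * y ∧
      IsCoprime x y ∧ G * conj G = n.map Complex.ofRealHom ∧
      rgcd (P * k * star P) = normalize n := by
  obtain ⟨G, x, y, α, β, hG, hx, hy, hxy⟩ := exists_gcd_mul (parts_ne_zero hP)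
  obtain ⟨n, hn⟩ := exists_mul_conj_eq G
  have hxy' : conj α * conj x + conj β * conj y = 1 := by
    rw [← map_mul, ← map_mul, ← map_add, hxy, map_one]
  have hK := hopf_imK P
  have hIJ := hopf_imI_imJ P
  rw [hx, hy, map_mul, map_mul] at hK
  rw [hx, hy, map_mul] at hIJ
  have hC : C (1 / 2 : ℂ) * 2 = (1 : ℂ[X]) := by
    rw [show (2 : ℂ[X]) = C 2 from rfl, ← C_mul]
    norm_num
  refine ⟨G, x, y, n, hG, hx, hy, ⟨α, β, hxy⟩, hn, rgcd_eq_normalize fun f => ?_⟩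
  rw [sandwich_re]
  constructor
  · intro hf
    have hf' : f.map Complex.ofRealHom ∣ G * conj G := by
      rw [hn]
      exact map_dvd_map_iff.2 hf
    have h1 : f.map Complex.ofRealHom ∣ ofParts (-(P * k * star P).imJ) (P * k * star P).imI := by
      rw [← hIJ]
      exact hf'.trans ⟨2 * (x * conj y), by ring⟩
    rw [map_dvd_ofParts, dvd_neg] at h1
    refine ⟨dvd_zero _, h1.2, h1.1, map_dvd_map_iff.1 ?_⟩
    rw [← hK]
    exact hf'.trans ⟨x * conj x - y * conj y, by ring⟩
  · rintro ⟨-, h1, h2, h3⟩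
    rw [← map_dvd_map_iff, ← hn]
    have hm : f.map Complex.ofRealHom ∣ G * conj G * (x * conj y) := by
      have := (map_dvd_ofParts (f := f)).2 ⟨(dvd_neg.2 h2), h1⟩
      rw [← hIJ] at this
      exact (this.mul_left (C (1 / 2))).trans ⟨1, by
        linear_combination (-(G * x * (conj G * conj y))) * hC⟩
    refine dvd_of_dvd_hopf hxy hxy' hm ?_ ?_
    · have := conj_dvd_conj hm
      rw [conj_map_ofReal] at this
      refine this.trans ⟨1, ?_⟩
      simp only [map_mul, conj_conj]
      ring
    · have := (map_dvd_map_iff (f := f)).2 h3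
      rw [← hK] at this
      exact this.trans ⟨1, by ring⟩

theorem ne_zero_of_rgcd_sandwich {Q : QuatPoly} (h : rgcd (Q * k * star Q) = 1) : Q ≠ 0 := by
  rintro rfl
  rw [star_zero, mul_zero] at h
  have h1 : (0 : ℝ[X]) ∣ 1 := by
    rw [← h, dvd_rgcd_iff]
    exact ⟨dvd_rfl, dvd_rfl, dvd_rfl, dvd_rfl⟩
  exact one_ne_zero (zero_dvd_iff.1 h1)

theorem isCoprime_parts {Q : QuatPoly} (h : rgcd (Q * k * star Q) = 1) :
    IsCoprime (fstPart Q) (sndPart Q) := by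
  obtain ⟨G, x, y, n, -, hx, hy, hxy, hn, hgcd⟩ := exists_gcd_parts (ne_zero_of_rgcd_sandwich h)
  rw [h] at hgcd
  have hGu : IsUnit G := by
    refine isUnit_of_mul_isUnit_left (y := conj G) ?_
    rw [hn]
    exact (normalize_eq_one.1 hgcd.symm).map (mapRingHom Complex.ofRealHom)
  rw [hx, hy]
  exact (isCoprime_mul_unit_left hGu x y).2 hxy

/-- A primitive vector polynomial whose norm is a square has the form `Q 𝐤 Q̄`. -/
theorem exists_sandwich_eq {v : QuatPoly} {σ : ℝ[X]} (h0 : v.re = 0) (hv : rgcd v = 1)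
    (hσ : v.imI ^ 2 + v.imJ ^ 2 + v.imK ^ 2 = σ ^ 2) : ∃ Q : QuatPoly, Q * k * star Q = v := by
  set c : ℝ[X] := C (1 / 2) with hc
  have hc2 : c * 2 = 1 := by
    rw [hc, show (2 : ℝ[X]) = C 2 from rfl, ← C_mul]
    norm_num
  obtain ⟨α, β, γ, δ, hcomb⟩ := exists_combination_eq_rgcd v
  rw [h0, hv, mul_zero, zero_add] at hcomb
  have hab : ((c * (σ + v.imK)) * (c * (σ - v.imK))).map Complex.ofRealHom =
      ofParts (c * -v.imJ) (c * v.imI) * conj (ofParts (c * -v.imJ) (c * v.imI)) := by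
    rw [conj_ofParts, ofParts_mul, ← ofParts_zero_right, ofParts_inj]
    constructor
    · linear_combination (-c ^ 2) * hσ
    · ring
  have hIf : (C Complex.I * C (-Complex.I) : ℂ[X]) = 1 := by
    rw [← C_mul]
    simp
  have hcop : ∀ f : ℂ[X], f ∣ (c * (σ + v.imK)).map Complex.ofRealHom →
      f ∣ (c * (σ - v.imK)).map Complex.ofRealHom → f ∣ ofParts (c * -v.imJ) (c * v.imI) →
      f ∣ conj (ofParts (c * -v.imJ) (c * v.imI)) → IsUnit f := by
    rintro f ⟨e1, h1⟩ ⟨e2, h2⟩ ⟨e3, h3⟩ ⟨e4, h4⟩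
    rw [conj_ofParts] at h4
    have hone := congrArg (Polynomial.map Complex.ofRealHom) hcomb
    have hc2' := congrArg (Polynomial.map Complex.ofRealHom) hc2
    simp only [ofParts, Polynomial.map_mul, Polynomial.map_add, Polynomial.map_sub,
      Polynomial.map_neg, Polynomial.map_one, Polynomial.map_ofNat] at h1 h2 h3 h4 hone hc2'
    -- the coordinates of `v` are `ζ̄ - ζ` times `I`, `-(ζ + ζ̄)` and `a - b`
    refine isUnit_of_dvd_one ⟨β.map Complex.ofRealHom * C (-Complex.I) * (e3 - e4)
      - γ.map Complex.ofRealHom * (e3 + e4) + δ.map Complex.ofRealHom * (e1 - e2), ?_⟩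
    rw [← hone]
    linear_combination (β.map Complex.ofRealHom * C (-Complex.I)) * (h3 - h4)
      - γ.map Complex.ofRealHom * (h3 + h4) + δ.map Complex.ofRealHom * (h1 - h2)
      - β.map Complex.ofRealHom * v.imI.map Complex.ofRealHom * hc2'
      - γ.map Complex.ofRealHom * v.imJ.map Complex.ofRealHom * hc2'
      - δ.map Complex.ofRealHom * v.imK.map Complex.ofRealHom * hc2'
      - β.map Complex.ofRealHom * v.imI.map Complex.ofRealHom * 2 *
        c.map Complex.ofRealHom * hIf
  have hne : c * (σ + v.imK) ≠ 0 ∨ c * (σ - v.imK) ≠ 0 := by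
    by_contra! h
    rw [h.1, h.2] at hab hcop
    have hζ : ofParts (c * -v.imJ) (c * v.imI) = 0 := by
      by_contra hζ
      exact mul_ne_zero hζ (conj_ne_zero hζ) (by rw [← hab]; simp)
    have := hcop 0 (by simp) (by simp) (by rw [hζ]) (by rw [hζ, map_zero])
    exact not_isUnit_zero this
  obtain ⟨q, r, hqr, hd⟩ := exists_hopf hne hab hcop
  obtain ⟨Q, rfl, rfl⟩ := exists_of_parts q r
  refine ⟨Q, sandwich_eq_of_hopf h0 ?_ ?_⟩
  · rw [hd, ← Polynomial.map_sub]
    congr 1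
    linear_combination v.imK * hc2
  · rw [← hqr, two_eq_ofParts, ofParts_mul, ofParts_inj]
    constructor
    · linear_combination (-v.imJ) * hc2
    · linear_combination v.imI * hc2

/-! ### Degrees -/

theorem deg_eq_max_parts (P : QuatPoly) :
    deg P = max (fstPart P).natDegree (sndPart P).natDegree := by
  have h1 := natDegree_ofParts_le P.re P.imK
  have h2 := natDegree_ofParts_le P.imI (-P.imJ)
  have h3 := natDegree_le_of_ofParts P.re P.imK
  have h4 := natDegree_le_of_ofParts P.imI (-P.imJ)
  rw [natDegree_neg] at h2 h4
  rw [deg, fstPart, sndPart]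
  omega

/-- There is no cancellation of leading terms in a sum of four real squares. -/
theorem natDegree_norm (P : QuatPoly) :
    (P.re ^ 2 + P.imI ^ 2 + P.imJ ^ 2 + P.imK ^ 2).natDegree = 2 * deg P := by
  have h1 : P.re.natDegree ≤ deg P := (le_max_left _ _).trans (le_max_left _ _)
  have h2 : P.imI.natDegree ≤ deg P := (le_max_right _ _).trans (le_max_left _ _)
  have h3 : P.imJ.natDegree ≤ deg P := (le_max_left _ _).trans (le_max_right _ _)
  have h4 : P.imK.natDegree ≤ deg P := (le_max_right _ _).trans (le_max_right _ _)
  apply le_antisymm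
  · refine natDegree_add_le_of_degree_le (natDegree_add_le_of_degree_le
      (natDegree_add_le_of_degree_le ?_ ?_) ?_) ?_
    all_goals exact natDegree_pow_le_of_le 2 ‹_›
  · by_cases h0 : deg P = 0
    · simp [h0]
    apply le_natDegree_of_ne_zero
    have hc : ∀ f : ℝ[X], f.natDegree ≤ deg P → (f ^ 2).coeff (2 * deg P) = f.coeff (deg P) ^ 2 :=
      fun f hf => coeff_pow_of_natDegree_le hf
    rw [coeff_add, coeff_add, coeff_add, hc _ h1, hc _ h2, hc _ h3, hc _ h4]
    have hlc : ∀ f : ℝ[X], f.natDegree = deg P → f.coeff (deg P) ≠ 0 := by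
      intro f hf hcf
      rw [← hf] at hcf
      have hf0 : f = 0 := leadingCoeff_eq_zero.1 hcf
      rw [hf0, natDegree_zero] at hf
      exact h0 hf.symm
    intro hsum
    have hz : P.re.coeff (deg P) = 0 ∧ P.imI.coeff (deg P) = 0 ∧ P.imJ.coeff (deg P) = 0 ∧
        P.imK.coeff (deg P) = 0 := by
      refine ⟨?_, ?_, ?_, ?_⟩ <;> nlinarith [sq_nonneg (P.re.coeff (deg P)),
        sq_nonneg (P.imI.coeff (deg P)), sq_nonneg (P.imJ.coeff (deg P)),
        sq_nonneg (P.imK.coeff (deg P))]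
    have hmax : P.re.natDegree = deg P ∨ P.imI.natDegree = deg P ∨ P.imJ.natDegree = deg P ∨
        P.imK.natDegree = deg P := by
      unfold deg
      omega
    rcases hmax with h | h | h | h
    · exact hlc _ h hz.1
    · exact hlc _ h hz.2.1
    · exact hlc _ h hz.2.2.1
    · exact hlc _ h hz.2.2.2

theorem sandwich_norm (P : QuatPoly) : (P * k * star P).imI ^ 2 + (P * k * star P).imJ ^ 2 +
    (P * k * star P).imK ^ 2 = (P.re ^ 2 + P.imI ^ 2 + P.imJ ^ 2 + P.imK ^ 2) ^ 2 := by
  rw [sandwich_imI, sandwich_imJ, sandwich_imK]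
  ring

/-- If `P 𝐤 P̄` has norm `r²`, then `|P|² = ± r` determines the degree of `P`. -/
theorem two_mul_deg_of_sandwich {P v : QuatPoly} {r : ℝ[X]} (h : P * k * star P = v)
    (hv : v.imI ^ 2 + v.imJ ^ 2 + v.imK ^ 2 = r ^ 2) : 2 * deg P = r.natDegree := by
  rw [← h, sandwich_norm] at hv
  rw [← natDegree_norm]
  rcases sq_eq_sq_iff_eq_or_eq_neg.1 hv with h | h
  · rw [h]
  · rw [h, natDegree_neg]

theorem ne_zero_of_norm_eq {v : QuatPoly} {s : ℝ[X]} (h0 : v.re = 0) (hv : rgcd v ≠ 0)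
    (hs : v.imI ^ 2 + v.imJ ^ 2 + v.imK ^ 2 = s ^ 2) : s ≠ 0 := by
  rintro rfl
  have h : ∀ x : ℝ, v.imI.eval x = 0 ∧ v.imJ.eval x = 0 ∧ v.imK.eval x = 0 := by
    intro x
    have h1 := congrArg (eval x) hs
    simp only [eval_add, eval_pow, eval_zero] at h1
    refine ⟨?_, ?_, ?_⟩ <;>
      nlinarith [sq_nonneg (v.imI.eval x), sq_nonneg (v.imJ.eval x), sq_nonneg (v.imK.eval x)]
  apply hv
  rw [← zero_dvd_iff, dvd_rgcd_iff]
  simp only [zero_dvd_iff]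
  exact ⟨h0, Polynomial.funext fun x => by rw [(h x).1, eval_zero],
    Polynomial.funext fun x => by rw [(h x).2.1, eval_zero],
    Polynomial.funext fun x => by rw [(h x).2.2, eval_zero]⟩

end QuatPoly

theorem rootMultiplicity_eq_of_associated {p q : ℝ[X]} (h : Associated p q) (a : ℝ) :
    p.rootMultiplicity a = q.rootMultiplicity a := by
  by_cases hp : p = 0
  · subst hp
    rw [(associated_zero_iff_eq_zero q).1 h.symm]
  have hq : q ≠ 0 := h.ne_zero_iff.1 hp
  exact le_antisymm (rootMultiplicity_le_rootMultiplicity_of_dvd hq h.dvd a)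
    (rootMultiplicity_le_rootMultiplicity_of_dvd hp h.symm.dvd a)

namespace DualQuatPoly

open QuatPoly

/-! ### Saturation -/

theorem isSaturated_smul_iff {u : DualQuatPoly} {f : ℝ[X]} :
    IsSaturated (f • u) ↔ f * QuatPoly.rgcd u.fst ≠ 0 ∧
      ∀ a : ℝ, Even ((f * QuatPoly.rgcd u.fst).rootMultiplicity a) := by
  have h : Associated (QuatPoly.rgcd (f • u).fst) (f * QuatPoly.rgcd u.fst) := by
    rw [TrivSqZeroExt.fst_smul, QuatPoly.rgcd_smul]
    exact (normalize_associated f).mul_right _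
  rw [IsSaturated, h.ne_zero_iff]
  simp only [rootMultiplicity_eq_of_associated h]

theorem IsReduced.isCoprime {u : DualQuatPoly} (hu : IsPlane u) (h : IsReduced u) :
    IsCoprime (QuatPoly.rgcd u.fst) u.snd.re := by
  have h1 : IsUnit (EuclideanDomain.gcd (QuatPoly.rgcd u.fst) (QuatPoly.rgcd u.snd)) :=
    normalize_eq_one.1 h
  refine (EuclideanDomain.gcd_isUnit_iff.1 h1).of_isCoprime_of_dvd_right ?_
  rw [dvd_rgcd_iff, hu.2.1, hu.2.2.1, hu.2.2.2]
  simp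

theorem IsKinematic.exists_norm_eq {u : DualQuatPoly} (hu : IsPlane u) (h : IsKinematic u) :
    ∃ s : ℝ[X], u.fst.imI ^ 2 + u.fst.imJ ^ 2 + u.fst.imK ^ 2 = s ^ 2 := by
  obtain ⟨s, hs⟩ := h
  refine ⟨s, ?_⟩
  have h1 := congrArg (fun w : DualQuatPoly => w.fst.re) hs
  simp [conj, hu.1, -Quaternion.coe_pow] at h1
  linear_combination h1

/-- The saturating factor is the product of the `t - a` over the real zeros `a` of odd multiplicity
of the greatest common divisor of the vector part. -/
theorem IsSaturatingFactor.eq_prod {u : DualQuatPoly} {l : ℝ[X]} (h : IsSaturatingFactor u l) :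
    ∃ S : Finset ℝ, l = ∏ a ∈ S, (X - C a) ∧ l ∣ QuatPoly.rgcd u.fst ∧
      ∀ a, l.rootMultiplicity a ≤ 1 := by
  obtain ⟨hmon, hsat, hmin⟩ := h
  rw [isSaturated_smul_iff] at hsat
  set g := QuatPoly.rgcd u.fst with hg
  obtain ⟨hlg, heven⟩ := hsat
  have hg0 : g ≠ 0 := right_ne_zero_of_mul hlg
  classical
  set S : Finset ℝ := g.roots.toFinset.filter fun a => Odd (g.rootMultiplicity a) with hS
  have hmem : ∀ a, a ∈ S ↔ Odd (g.rootMultiplicity a) := by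
    intro a
    rw [hS, Finset.mem_filter, Multiset.mem_toFinset, and_iff_right_iff_imp, mem_roots hg0]
    exact fun h => (rootMultiplicity_pos hg0).1 h.pos
  set L : ℝ[X] := ∏ a ∈ S, (X - C a) with hL
  have hLmon : L.Monic := monic_prod_of_monic _ _ fun a _ => monic_X_sub_C a
  have hroots : L.roots = S.val := roots_prod_X_sub_C S
  have hLmult : ∀ a, L.rootMultiplicity a = if a ∈ S then 1 else 0 := by
    intro a
    rw [← count_roots, hroots, Multiset.count_eq_of_nodup S.nodup]
    rfl
  have hdvd : ∀ p : ℝ[X], p ≠ 0 → (∀ a ∈ S, p.IsRoot a) → L ∣ p := by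
    intro p hp hr
    refine (Multiset.prod_X_sub_C_dvd_iff_le_roots hp S.val).2 ?_
    exact (Multiset.le_iff_subset S.nodup).2 fun a ha => (mem_roots hp).2 (hr a ha)
  have hLl : L ∣ l := by
    refine hdvd l hmon.ne_zero fun a ha => (rootMultiplicity_pos hmon.ne_zero).1 ?_
    have h1 := heven a
    rw [rootMultiplicity_mul hlg] at h1
    have h2 := (hmem a).1 ha
    refine Nat.pos_of_ne_zero fun h3 => ?_
    rw [h3, zero_add] at h1
    exact (Nat.not_even_iff_odd.2 h2) h1
  have hLsat : IsSaturated (L • u) := by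
    rw [isSaturated_smul_iff]
    refine ⟨mul_ne_zero hLmon.ne_zero hg0, fun a => ?_⟩
    rw [rootMultiplicity_mul (mul_ne_zero hLmon.ne_zero hg0), hLmult]
    split_ifs with ha
    · exact odd_one.add_odd ((hmem a).1 ha)
    · rw [zero_add, ← Nat.not_odd_iff_even]
      exact fun h => ha ((hmem a).2 h)
  have hlL : l = L :=
    eq_of_monic_of_dvd_of_natDegree_le hLmon hmon hLl (hmin L hLmon hLsat)
  refine ⟨S, hlL, ?_, fun a => ?_⟩
  · rw [hlL]
    exact hdvd g hg0 fun a ha => (rootMultiplicity_pos hg0).1 ((hmem a).1 ha).pos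
  · rw [hlL, hLmult]
    split_ifs <;> norm_num

theorem IsSaturatingFactor.isMinimallySaturated {u : DualQuatPoly} {l : ℝ[X]}
    (h : IsSaturatingFactor u l) (hcop : IsCoprime (QuatPoly.rgcd u.fst) u.snd.re) :
    IsMinimallySaturated (l • u) := by
  obtain ⟨S, hlS, -, hl1⟩ := h.eq_prod
  refine ⟨h.2.1, fun f w hf hw hws => ?_⟩
  have hl0 : l ≠ 0 := h.1.ne_zero
  obtain ⟨hne, heven⟩ := isSaturated_smul_iff.1 h.2.1
  obtain ⟨-, heven'⟩ := isSaturated_smul_iff.1 (hw ▸ h.2.1 : IsSaturated (f • w))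
  have hass : Associated (l * QuatPoly.rgcd u.fst) (f * QuatPoly.rgcd w.fst) := by
    have h1 := congrArg (fun v : DualQuatPoly => QuatPoly.rgcd v.fst) hw
    simp only [TrivSqZeroExt.fst_smul, QuatPoly.rgcd_smul] at h1
    exact ((normalize_associated l).symm.mul_right _).trans
      (by rw [h1]; exact (normalize_associated f).mul_right _)
  have hne' := hass.ne_zero_iff.1 hne
  have hfl : f ∣ l := by
    have h1 : f ∣ l * QuatPoly.rgcd u.fst := (dvd_mul_right f _).trans hass.symm.dvd
    have h2 : f ∣ l * u.snd.re :=
      ⟨w.snd.re, congrArg (fun v : DualQuatPoly => v.snd.re) hw⟩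
    obtain ⟨a, b, hab⟩ := hcop
    have h3 : l = a * (l * QuatPoly.rgcd u.fst) + b * (l * u.snd.re) := by
      linear_combination (-l) * hab
    rw [h3]
    exact dvd_add (h1.mul_left a) (h2.mul_left b)
  obtain ⟨a, ha⟩ : ∃ a, f.IsRoot a := by
    by_contra! hno
    have hc : IsCoprime f l := by
      rw [hlS]
      refine IsCoprime.prod_right fun a _ => IsCoprime.symm ?_
      exact (irreducible_X_sub_C a).coprime_iff_not_dvd.2 fun hd => hno a (dvd_iff_isRoot.1 hd)
    have := natDegree_eq_zero_of_isUnit (hc.isUnit_of_dvd' dvd_rfl hfl)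
    omega
  have hf0 : f ≠ 0 := left_ne_zero_of_mul hne'
  have h1 : f.rootMultiplicity a = 1 := le_antisymm
    ((rootMultiplicity_le_rootMultiplicity_of_dvd hl0 hfl a).trans (hl1 a))
    ((rootMultiplicity_pos hf0).2 ha)
  have h2 := heven' a
  rw [rootMultiplicity_mul hne', h1] at h2
  have h3 := hws.2 a
  rw [Nat.even_add] at h2
  simp [h3] at h2

/-! ### Solutions of the system -/

theorem isSolution_smul_iff {u C : DualQuatPoly} {l h : ℝ[X]} :
    IsSolution (l • u) h C ↔ IsSolution u (h * l) C := by
  simp only [IsSolution, TrivSqZeroExt.fst_smul, TrivSqZeroExt.snd_smul, smul_smul]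

/-- The system in the complex coordinates of the primal and the dual part. -/
theorem isSolution_iff {u C : DualQuatPoly} {c : ℝ[X]} (hu : IsPlane u) :
    IsSolution u c C ↔ C.fst ≠ 0 ∧ C.fst * k * star C.fst = c • u.fst ∧
      2 * (ComplexPoly.conj (fstPart C.fst) * fstPart C.snd +
        ComplexPoly.conj (sndPart C.fst) * sndPart C.snd) = ofParts 0 (c * u.snd.re) := by
  have h := study_iff (P := C.fst) (D := C.snd) (v := c • u.snd)
    (by change c * u.snd.imI = 0; rw [hu.2.1, mul_zero])
    (by change c * u.snd.imJ = 0; rw [hu.2.2.1, mul_zero])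
    (by change c * u.snd.imK = 0; rw [hu.2.2.2, mul_zero])
  have h' : (c • u.snd).re = c * u.snd.re := rfl
  rw [h'] at h
  rw [IsSolution, IsMotion, ← h]
  exact ⟨fun ⟨⟨h1, h2⟩, h3, h4⟩ => ⟨h1, h3, h2, h4⟩, fun ⟨h1, h3, h2, h4⟩ => ⟨⟨h1, h2⟩, h3, h4⟩⟩

theorem IsSolution.rgcd_dvd_and_isSaturated {u C : DualQuatPoly} {c : ℝ[X]} (hu : IsPlane u)
    (hcop : IsCoprime (QuatPoly.rgcd u.fst) u.snd.re) (h : IsSolution u c C) :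
    QuatPoly.rgcd u.fst ∣ c ∧ IsSaturated (c • u) := by
  obtain ⟨hP, hsand, hdual⟩ := (isSolution_iff hu).1 h
  obtain ⟨G, x, y, n, hG, hx, hy, -, hn, hgcd⟩ := exists_gcd_parts hP
  set g := QuatPoly.rgcd u.fst with hg
  have hgn : normalize g = g := normalize_rgcd u.fst
  rw [hsand, rgcd_smul, ← hg, ← hgn, ← normalize_mul,
    normalize_eq_normalize_iff_associated] at hgcd
  have hGG : G * ComplexPoly.conj G ≠ 0 := mul_ne_zero hG (conj_ne_zero hG)
  have hn0 : n ≠ 0 := by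
    rintro rfl
    exact hGG (by rw [hn, Polynomial.map_zero])
  constructor
  · have hass : Associated ((c * g).map Complex.ofRealHom) (G * ComplexPoly.conj G) := by
      rw [hn]
      exact hgcd.map (mapRingHom Complex.ofRealHom)
    -- `G` divides both `c g` and `c u₀`, hence `c`
    have h1 : G ∣ (c * g).map Complex.ofRealHom := (dvd_mul_right G _).trans hass.symm.dvd
    have h2 : G ∣ (c * u.snd.re).map Complex.ofRealHom := by
      have h3 : ComplexPoly.conj G ∣ ofParts 0 (c * u.snd.re) := by
        rw [← hdual, hx, hy, map_mul, map_mul]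
        exact ⟨2 * (ComplexPoly.conj x * fstPart C.snd + ComplexPoly.conj y * sndPart C.snd),
          by ring⟩
      have h4 := conj_dvd_conj h3
      rw [ComplexPoly.conj_conj, conj_ofParts] at h4
      refine h4.trans ⟨Polynomial.C Complex.I, ?_⟩
      simp only [ofParts, Polynomial.map_neg, Polynomial.map_zero]
      linear_combination (c * u.snd.re).map Complex.ofRealHom * C_I_sq
    obtain ⟨a, b, hab⟩ := hcop
    have hGc : G ∣ c.map Complex.ofRealHom := by
      have h3 : c = a * (c * g) + b * (c * u.snd.re) := by
        linear_combination (-c) * hab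
      have h4 : c.map Complex.ofRealHom = a.map Complex.ofRealHom * (c * g).map Complex.ofRealHom +
          b.map Complex.ofRealHom * (c * u.snd.re).map Complex.ofRealHom := by
        rw [← Polynomial.map_mul, ← Polynomial.map_mul, ← Polynomial.map_add, ← h3]
      rw [h4]
      exact dvd_add (h1.mul_left _) (h2.mul_left _)
    -- cancelling `G` in `c g ~ G Ḡ` shows that `g` divides `Ḡ`, hence `G`
    obtain ⟨H, hH⟩ := hGc
    have hgG : g.map Complex.ofRealHom ∣ ComplexPoly.conj G := by
      have h3 := hass.dvd
      rw [Polynomial.map_mul, hH, mul_assoc] at h3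
      exact (dvd_mul_left _ H).trans ((mul_dvd_mul_iff_left hG).1 h3)
    have hgG' := conj_dvd_conj hgG
    rw [ComplexPoly.conj_conj, conj_map_ofReal] at hgG'
    exact map_dvd_map_iff.1 (hgG'.trans ⟨H, hH⟩)
  · rw [isSaturated_smul_iff]
    refine ⟨hgcd.ne_zero_iff.2 hn0, fun a => ?_⟩
    rw [rootMultiplicity_eq_of_associated hgcd]
    exact rootMultiplicity_of_mul_conj hG hn a

/-- For a norm `M M̄ = ± m`, the polynomial `g M Q` with `Q 𝐤 Q̄ = ± u⃗ / g` is the primal part of a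
solution for the factor `g m`, and its dual part can be chosen of low degree. The sign is `δ`, and
`n` is the degree of `Q`. -/
theorem exists_isSolution {u : DualQuatPoly} {m s δ : ℝ[X]} {M : ℂ[X]} (hu : IsPlane u)
    (hg : QuatPoly.rgcd u.fst ≠ 0)
    (hs : u.fst.imI ^ 2 + u.fst.imJ ^ 2 + u.fst.imK ^ 2 = s ^ 2) (hδ : δ ^ 2 = 1) (hM : M ≠ 0)
    (hMm : M * ComplexPoly.conj M = (δ * m).map Complex.ofRealHom) :
    ∃ (C : DualQuatPoly) (n : ℕ), IsSolution u (QuatPoly.rgcd u.fst * m) C ∧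
      s.natDegree = (QuatPoly.rgcd u.fst).natDegree + 2 * n ∧
      C.snd.deg ≤ max n (M.natDegree + u.snd.re.natDegree - n) := by
  obtain ⟨w, hw⟩ := eq_rgcd_smul u.fst
  set g := QuatPoly.rgcd u.fst with hgdef
  have hwre : w.re = 0 := by
    have h1 : u.fst.re = g * w.re := congrArg QuaternionAlgebra.re hw
    rw [hu.1] at h1
    exact (mul_eq_zero.1 h1.symm).resolve_left hg
  have hw1 : QuatPoly.rgcd w = 1 := by
    have h1 : g = normalize g * QuatPoly.rgcd w := by
      rw [← rgcd_smul, ← hw]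
    rw [hgdef, normalize_rgcd, ← hgdef] at h1
    exact (mul_eq_left₀ hg).1 h1.symm
  have hnorm : g ^ 2 * (w.imI ^ 2 + w.imJ ^ 2 + w.imK ^ 2) = s ^ 2 := by
    rw [← hs, hw]
    change _ = (g * w.imI) ^ 2 + (g * w.imJ) ^ 2 + (g * w.imK) ^ 2
    ring
  obtain ⟨σ, rfl⟩ : g ∣ s := (IsIntegrallyClosed.pow_dvd_pow_iff two_ne_zero).1 ⟨_, hnorm.symm⟩
  have hσ : w.imI ^ 2 + w.imJ ^ 2 + w.imK ^ 2 = σ ^ 2 :=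
    mul_left_cancel₀ (pow_ne_zero 2 hg) (by rw [hnorm]; ring)
  have hδu : normalize δ = 1 := normalize_eq_one.2
    (IsUnit.of_mul_eq_one δ (by rw [← sq, hδ]))
  have hδσ : (δ • w).imI ^ 2 + (δ • w).imJ ^ 2 + (δ • w).imK ^ 2 = σ ^ 2 := by
    change (δ * w.imI) ^ 2 + (δ * w.imJ) ^ 2 + (δ * w.imK) ^ 2 = σ ^ 2
    linear_combination (w.imI ^ 2 + w.imJ ^ 2 + w.imK ^ 2) * hδ + hσ
  have hδ1 : QuatPoly.rgcd (δ • w) = 1 := by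
    rw [rgcd_smul, hδu, hw1, one_mul]
  obtain ⟨Q, hQ⟩ := exists_sandwich_eq (v := δ • w)
    (by change δ * w.re = 0; rw [hwre, mul_zero]) hδ1 hδσ
  have hQ0 : Q ≠ 0 := ne_zero_of_rgcd_sandwich (by rw [hQ, hδ1])
  have hQdeg := two_mul_deg_of_sandwich hQ hδσ
  have hσ0 : σ ≠ 0 := ne_zero_of_norm_eq hwre (by rw [hw1]; exact one_ne_zero) hσ
  have hQcop := (isCoprime_parts (by rw [hQ, hδ1])).map ComplexPoly.conj
  obtain ⟨d, e, hde, hd, he⟩ := exists_bezout_natDegree_le hQcop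
    (M * ofParts 0 (Polynomial.C (1 / 2) * (δ * u.snd.re)))
  obtain ⟨P, hP1, hP2⟩ := exists_of_parts (g.map Complex.ofRealHom * M * fstPart Q)
    (g.map Complex.ofRealHom * M * sndPart Q)
  obtain ⟨D, rfl, rfl⟩ := exists_of_parts d e
  have hg' : g.map Complex.ofRealHom ≠ 0 :=
    (Polynomial.map_ne_zero_iff Complex.ofRealHom.injective).2 hg
  have hδC := congrArg (Polynomial.map Complex.ofRealHom) hδ
  rw [Polynomial.map_pow, Polynomial.map_one] at hδC
  rw [Polynomial.map_mul] at hMm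
  have hgC := conj_map_ofReal g
  set gC := g.map Complex.ofRealHom
  set mC := m.map Complex.ofRealHom
  set δC := δ.map Complex.ofRealHom
  refine ⟨TrivSqZeroExt.inl P + TrivSqZeroExt.inr D, Q.deg,
    (isSolution_iff hu).2 ⟨?_, ?_, ?_⟩, ?_, ?_⟩
  · simp only [TrivSqZeroExt.fst_add, TrivSqZeroExt.fst_inl, TrivSqZeroExt.fst_inr, add_zero]
    intro hP
    have h0 : ofParts 0 0 = 0 := by simp [ofParts]
    have h1 : fstPart P = 0 := by rw [hP]; exact h0
    have h2 : sndPart P = 0 := by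
      rw [hP]
      exact (congrArg (ofParts 0) neg_zero).trans h0
    have hgM := mul_ne_zero hg' hM
    rcases parts_ne_zero hQ0 with h | h
    · exact mul_ne_zero hgM h (by rw [← hP1, h1])
    · exact mul_ne_zero hgM h (by rw [← hP2, h2])
  · simp only [TrivSqZeroExt.fst_add, TrivSqZeroExt.fst_inl, TrivSqZeroExt.fst_inr, add_zero]
    have hK := hopf_imK Q
    have hIJ := hopf_imI_imJ Q
    rw [hQ] at hK hIJ
    have hwK : (δ • w).imK = δ * w.imK := rfl
    have hwIJ : ofParts (-(δ • w).imJ) (δ • w).imI =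
        δ.map Complex.ofRealHom * ofParts (-w.imJ) w.imI := by
      rw [map_mul_ofParts, mul_neg]
      rfl
    rw [hwK, Polynomial.map_mul] at hK
    rw [hwIJ] at hIJ
    refine sandwich_eq_of_hopf ?_ ?_ ?_
    · change g * m * u.fst.re = 0
      rw [hu.1, mul_zero]
    · have hv : ((g * m) • u.fst).imK = g * m * (g * w.imK) := by rw [hw]; rfl
      rw [hv, hP1, hP2]
      simp only [map_mul, Polynomial.map_mul, hgC]
      linear_combination (gC ^ 2 * (M * ComplexPoly.conj M)) * hK +
        gC ^ 2 * δC * w.imK.map Complex.ofRealHom * hMm +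
        gC ^ 2 * mC * w.imK.map Complex.ofRealHom * hδC
    · have hv : ofParts (-((g * m) • u.fst).imJ) ((g * m) • u.fst).imI =
          gC * mC * (gC * ofParts (-w.imJ) w.imI) := by
        rw [map_mul_ofParts, ← Polynomial.map_mul, map_mul_ofParts, hw, mul_neg, mul_neg]
        rfl
      rw [hv, hP1, hP2]
      simp only [map_mul, hgC]
      linear_combination (gC ^ 2 * (M * ComplexPoly.conj M)) * hIJ +
        gC ^ 2 * δC * ofParts (-w.imJ) w.imI * hMm +
        gC ^ 2 * mC * ofParts (-w.imJ) w.imI * hδC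
  · simp only [TrivSqZeroExt.fst_add, TrivSqZeroExt.fst_inl, TrivSqZeroExt.fst_inr, add_zero,
      TrivSqZeroExt.snd_add, TrivSqZeroExt.snd_inl, TrivSqZeroExt.snd_inr, zero_add]
    have hC : (Polynomial.C (1 / 2 : ℝ)).map Complex.ofRealHom * 2 = 1 := by
      rw [map_C, show (2 : ℂ[X]) = Polynomial.C 2 from rfl, ← C_mul]
      norm_num
    rw [hP1, hP2]
    simp only [map_mul, hgC, ofParts, Polynomial.map_mul, Polynomial.map_zero,
      zero_add] at hde ⊢
    linear_combination (2 * gC * ComplexPoly.conj M) * hde +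
      2 * gC * Polynomial.C Complex.I * (Polynomial.C (1 / 2 : ℝ)).map Complex.ofRealHom * δC *
        u.snd.re.map Complex.ofRealHom * hMm +
      gC * mC * Polynomial.C Complex.I * u.snd.re.map Complex.ofRealHom * δC ^ 2 * hC +
      gC * mC * Polynomial.C Complex.I * u.snd.re.map Complex.ofRealHom * hδC
  · rw [natDegree_mul hg hσ0, hQdeg]
  · simp only [TrivSqZeroExt.snd_add, TrivSqZeroExt.snd_inl, TrivSqZeroExt.snd_inr, zero_add]
    rw [natDegree_conj, natDegree_conj, ← deg_eq_max_parts] at hd he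
    have hδ0 : δ.natDegree = 0 := natDegree_eq_zero_of_isUnit
      (IsUnit.of_mul_eq_one δ (by rw [← sq, hδ]))
    have hrhs : (M * ofParts 0 (Polynomial.C (1 / 2) * (δ * u.snd.re))).natDegree ≤
        M.natDegree + u.snd.re.natDegree := by
      refine natDegree_mul_le.trans (Nat.add_le_add_left ((natDegree_ofParts_le _ _).trans ?_) _)
      rw [natDegree_zero, Nat.zero_max]
      refine natDegree_mul_le.trans ?_
      rw [natDegree_C, zero_add]
      refine natDegree_mul_le.trans ?_
      rw [hδ0, zero_add]
    rw [deg_eq_max_parts D]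
    omega

/-- The degree of the primal part and a bound for the degree of the dual part of a solution. -/
theorem IsSolution.degrees {u C : DualQuatPoly} {c s : ℝ[X]} (hu : IsPlane u) (hc : c ≠ 0)
    (hs0 : s ≠ 0) (hs : u.fst.imI ^ 2 + u.fst.imJ ^ 2 + u.fst.imK ^ 2 = s ^ 2)
    (h : IsSolution u c C) : 2 * C.fst.deg = c.natDegree + s.natDegree ∧
      (c * u.snd.re).natDegree ≤ C.fst.deg + C.snd.deg := by
  obtain ⟨-, hsand, hdual⟩ := (isSolution_iff hu).1 h
  constructor
  · rw [← natDegree_mul hc hs0]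
    refine two_mul_deg_of_sandwich hsand ?_
    change (c * u.fst.imI) ^ 2 + (c * u.fst.imJ) ^ 2 + (c * u.fst.imK) ^ 2 = _
    rw [mul_pow c s, ← hs]
    ring
  · refine (natDegree_le_of_ofParts 0 (c * u.snd.re)).2.trans ?_
    rw [← hdual, deg_eq_max_parts C.fst, deg_eq_max_parts C.snd, ← natDegree_conj (fstPart C.fst),
      ← natDegree_conj (sndPart C.fst), show (2 : ℂ[X]) = Polynomial.C 2 from rfl]
    refine natDegree_mul_le.trans ?_
    rw [natDegree_C, zero_add]
    refine (natDegree_add_le _ _).trans (max_le ?_ ?_)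
    · exact natDegree_mul_le.trans (add_le_add (le_max_left _ _) (le_max_left _ _))
    · exact natDegree_mul_le.trans (add_le_add (le_max_right _ _) (le_max_right _ _))

end DualQuatPoly

end

theorem proposition3 (u : DualQuatPoly) (l : Polynomial ℝ)
    (hplane : DualQuatPoly.IsPlane u)
    (hkin : DualQuatPoly.IsKinematic u)
    (hred : DualQuatPoly.IsReduced u)
    (hl : DualQuatPoly.IsSaturatingFactor u l) :
    DualQuatPoly.IsMinimallySaturated (l • u) ∧
    l ^ 2 ∣ QuatPoly.rgcd (l • u).fst ∧
    (∀ h : Polynomial ℝ,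
      (∃ C : DualQuatPoly, DualQuatPoly.IsSolution (l • u) h C) ↔
        (QuatPoly.rgcd (l • u).fst / l ^ 2 ∣ h ∧ DualQuatPoly.IsSaturated ((h * l) • u))) ∧
    (∃ C : DualQuatPoly,
      DualQuatPoly.IsSolution (l • u) (QuatPoly.rgcd (l • u).fst / l ^ 2) C ∧
      ∀ (h : Polynomial ℝ) (C' : DualQuatPoly),
        DualQuatPoly.IsSolution (l • u) h C' → DualQuatPoly.deg C ≤ DualQuatPoly.deg C') := by
  open DualQuatPoly in
  have hcop := hred.isCoprime hplane
  obtain ⟨s, hs⟩ := hkin.exists_norm_eq hplane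
  obtain ⟨-, -, ⟨g', hg'⟩, -⟩ := hl.eq_prod
  have hl0 : l ≠ 0 := hl.1.ne_zero
  have hrg : QuatPoly.rgcd (l • u).fst = l ^ 2 * g' := by
    rw [TrivSqZeroExt.fst_smul, QuatPoly.rgcd_smul, hl.1.normalize_eq_self, hg']
    ring
  have hg0 : QuatPoly.rgcd u.fst ≠ 0 :=
    right_ne_zero_of_mul (isSaturated_smul_iff.1 hl.2.1).1
  have hs0 : s ≠ 0 := QuatPoly.ne_zero_of_norm_eq hplane.1 hg0 hs
  have hdiv : QuatPoly.rgcd (l • u).fst / l ^ 2 = g' := by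
    rw [hrg, mul_div_cancel_left₀ _ (pow_ne_zero 2 hl0)]
  rw [hdiv]
  have hg'l : g' * l = QuatPoly.rgcd u.fst := by rw [hg', mul_comm]
  have hdvd : ∀ h, g' ∣ h ↔ QuatPoly.rgcd u.fst ∣ h * l := fun h => by
    rw [← hg'l, mul_dvd_mul_iff_right hl0]
  refine ⟨hl.isMinimallySaturated hcop, ⟨g', hrg⟩, fun h => ?_, ?_⟩
  · simp only [isSolution_smul_iff, hdvd]
    constructor
    · rintro ⟨C, hC⟩
      exact hC.rgcd_dvd_and_isSaturated hplane hcop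
    · rintro ⟨⟨m, hm⟩, hsat⟩
      rw [hm, isSaturated_smul_iff] at hsat
      obtain ⟨hne, heven⟩ := hsat
      have hm0 : m ≠ 0 := right_ne_zero_of_mul (left_ne_zero_of_mul hne)
      obtain ⟨M, hM⟩ := ComplexPoly.exists_norm_of_even hm0 fun a => by
        have h1 := heven a
        rw [rootMultiplicity_mul hne, rootMultiplicity_mul (left_ne_zero_of_mul hne)] at h1
        rw [Nat.even_iff] at h1 ⊢
        omega
      obtain ⟨δ, hδ, hMδ⟩ : ∃ δ : ℝ[X], δ ^ 2 = 1 ∧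
          M * ComplexPoly.conj M = (δ * m).map Complex.ofRealHom := by
        rcases hM with hM | hM
        · exact ⟨1, by norm_num, by rw [hM, one_mul]⟩
        · exact ⟨-1, by norm_num, by rw [hM, neg_one_mul]⟩
      have hM0 : M ≠ 0 := by
        rintro rfl
        rw [zero_mul, eq_comm, Polynomial.map_eq_zero_iff Complex.ofRealHom.injective] at hMδ
        rcases mul_eq_zero.1 hMδ with h0 | h0
        · rw [h0] at hδ
          norm_num at hδ
        · exact hm0 h0
      obtain ⟨C, -, hC, -⟩ := exists_isSolution hplane hg0 hs hδ hM0 hMδ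
      exact ⟨C, by rwa [hm]⟩
  · obtain ⟨C, n, hC, hn, hCd⟩ := exists_isSolution (m := 1) (δ := 1) (M := 1) hplane hg0 hs
      (one_pow 2) one_ne_zero (by simp)
    rw [mul_one] at hC
    refine ⟨C, isSolution_smul_iff.2 (by rwa [hg'l]), fun h C' hC' => ?_⟩
    rw [isSolution_smul_iff] at hC'
    obtain ⟨hgc, hsat⟩ := hC'.rgcd_dvd_and_isSaturated hplane hcop
    have hc0 : h * l ≠ 0 := left_ne_zero_of_mul (isSaturated_smul_iff.1 hsat).1
    have h1 := natDegree_le_of_dvd hgc hc0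
    obtain ⟨h2, -⟩ := hC.degrees hplane hg0 hs0 hs
    obtain ⟨h3, h4⟩ := hC'.degrees hplane hc0 hs0 hs
    rw [natDegree_one, zero_add] at hCd
    unfold DualQuatPoly.deg
    by_cases hu0 : u.snd.re = 0
    · rw [hu0, natDegree_zero] at hCd
      omega
    · rw [natDegree_mul hc0 hu0] at h4
      omega
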